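/- For $0<\lambda<1$ let $\mathbb G(\lambda)$ be the geometric probability mass function $\mathbb G(\lambda)(k)=(1-\lambda)\lambda^{k-1}$, $k\ge 1$; let $\mathbb I$ be the unit mass at $0$, $\otimes$ convolution, and $\bar x=1-x$. Consider, in discrete time (epochs), a tandem of two nodes. The first node has $m\ge 1$ buffer slots (including the packet in service) and is fed by a renewal process of packets whose inter-arrival law is a probability law of the form $g^{\rm in}=\sum_{i=1}^{N-1}p_i\,\mathbb G(\varepsilon_i)$, where $p_1,\dots,p_{N-1}\in\mathbb R$ (not necessarily nonnegative) and $\varepsilon_1,\dots,\varepsilon_{N-1}\in(0,1)$ are distinct. Its service times are independent with law $\mathbb G(\varepsilon_N)$, where $\varepsilon_N\in(0,1)$ and $\varepsilon_N\ne\varepsilon_i$ for all $i\le N-1$. When a service is completed, the packet arrives at the second node, which blocks it with probability $q\in(0,1)$, independently of everything else; a blocked packet stays in the first node and is serviced again with a new, independent service time, while an unblocked one leaves the first node. In each epoch the departure, if any, is processed before the arrival, if any; an arriving packet that then finds no free slot is lost; and a service that starts at the end of an epoch can be completed in the next epoch at the earliest. Describe the first node at the beginning of an epoch by the number of its packets,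 the time until its next arrival, and the remaining service time (when the buffer is empty, the latter is a placeholder redrawn from $\mathbb G(\varepsilon_N)$ in each epoch). Then this Markov chain has exactly one stationary law, and there are $\alpha\in(0,1)$ and real numbers $p'_1,\dots,p'_{N-1}$ with $\sum_{l}p'_l=1$, such that $\sum_l p'_l\,\mathbb G(\varepsilon_l)$ is a probability law and such that in steady state the law $g^{\rm out}$ of the inter-arrival times seen by the second node (the conditional law, given that a packet, blocked or not, arrives at the second node in an epoch, of the number of epochs until the next such arrival) is $$g^{\rm out}=\Bigl(\bar\alpha\,\mathbb I+\alpha\sum_{l=1}^{N-1}p'_l\,\mathbb G(\varepsilon_l)\Bigr)\otimes\mathbb G(\varepsilon_N).$$ -/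

import Mathlib

open scoped ENNReal

noncomputable section

namespace Tandem

/-- The probability mass function of a positive geometric random variable with mean `1 / (1 - r)`. -/
def geo (r : ℝ) (k : ℕ) : ℝ :=
  if k = 0 then 0 else (1 - r) * r ^ (k - 1)

/-- The identity for convolution: the unit mass at `0`. -/
def idConv (k : ℕ) : ℝ :=
  if k = 0 then 1 else 0

/-- Convolution of two functions on `ℕ`. -/
def convolve (f g : ℕ → ℝ) (k : ℕ) : ℝ :=
  ∑ i ∈ Finset.range (k + 1), f i * g (k - i)

/-- State of the first node at the beginning of an epoch:
* `occ`: the number of packets in its buffer;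
* `res`: the next packet arrives at the node in the `res`-th epoch, the current epoch being the
  first (the value `0` is never reached and is read as `1`);
* `srv`: if the buffer is not empty, the service in progress is completed in the `srv`-th epoch,
  the current epoch being the first (`0` is read as `1`); without meaning if the buffer is empty. -/
structure State where
  occ : ℕ
  res : ℕ
  srv : ℕ

/-- A service is completed in the current epoch, that is, a packet arrives at the second node. -/
def State.delivers (x : State) : Prop :=
  0 < x.occ ∧ x.srv ≤ 1

instance (x : State) : Decidable x.delivers :=
  inferInstanceAs (Decidable (_ ∧ _))

/-- One epoch of the first node with `m` buffer slots, in transmit-first mode. `blocked` says whether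
the second node blocks a packet that it receives in this epoch, `t` is the inter-arrival time that
starts if a packet arrives in this epoch, and `s` is the duration of the service that starts
(if any) at the end of this epoch.

First, if a service is completed, the packet is delivered to the second node; it leaves the first
node if it is not blocked and otherwise stays and is serviced anew. Then an arriving packet is
stored if there is a free slot, and is lost otherwise. -/
def State.next (m : ℕ) (x : State) (blocked : Bool) (t s : ℕ) : State :=
  let left := if x.delivers ∧ blocked = false then x.occ - 1 else x.occ
  { occ := if x.res ≤ 1 ∧ left < m then left + 1 else left
    res := if x.res ≤ 1 then t else x.res - 1
    srv := if 0 < x.occ ∧ 1 < x.srv then x.srv - 1 else s }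

/-- The transition law of the node: in every epoch, blocking, the next inter-arrival time and the
next service time are drawn independently from `blk`, `arr`, `svc`, and used when needed. -/
def step (m : ℕ) (arr svc : PMF ℕ) (blk : PMF Bool) (x : State) : PMF State :=
  blk.bind fun b => arr.bind fun t => svc.bind fun s => PMF.pure (x.next m b t s)

/-- `μ` is a steady-state law of the node. -/
def IsStationary (m : ℕ) (arr svc : PMF ℕ) (blk : PMF Bool) (μ : PMF State) : Prop :=
  μ.bind (step m arr svc blk) = μ

/-- The probability, from state `x`, that the first delivery in the current epoch or later takes
place exactly `k` epochs after the current one. -/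
def firstDelivery (m : ℕ) (arr svc : PMF ℕ) (blk : PMF Bool) : ℕ → State → ℝ≥0∞
  | 0, x => if x.delivers then 1 else 0
  | k + 1, x =>
      if x.delivers then 0 else ∑' y, step m arr svc blk x y * firstDelivery m arr svc blk k y

/-- The law of the inter-arrival times seen by the second node when the first node has the
steady-state law `μ`: the conditional probability, given that there is a delivery in an epoch,
that the next delivery takes place exactly `k` epochs later. All packets received by the second
node count, the blocked ones included. -/
def interArrival (m : ℕ) (arr svc : PMF ℕ) (blk : PMF Bool) (μ : PMF State) : ℕ → ℝ≥0∞
  | 0 => 0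
  | k + 1 =>
      (∑' x, if x.delivers then
        μ x * ∑' y, step m arr svc blk x y * firstDelivery m arr svc blk k y else 0) /
      ∑' x, if x.delivers then μ x else 0

end Tandem

end

/-!
The service times are geometric, hence memoryless: if the remaining service time is geometric and
independent of the number `j` of packets and the time `r` until the next arrival, it is so again
one epoch later (`mean_svc_step`). Averaged over the service time, `(j, r)` is a Markov chain in
which, in each epoch without an arrival, a packet leaves a nonempty node with a fixed probability.
At arrival epochs this chain is a chain on the finite set `{0, …, m}`, which has an invariant
law `π 0`. With `π u` for the law of the occupancy `u` epochs after an arrival, the measure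
`(∑ u, arr (r + u) * π u j) * svc s` is invariant (`occResMass_invariant`), and it is finite
as the inter-arrival times have a finite mean. The stationary law is unique because the empty node
with an imminent arrival is reached from every state (`reaches_empty`, `invariant_unique`); this
uses that the inter-arrival times are unbounded, by the linear independence of the sequences
`k ↦ ε i ^ k`.

If a delivery leaves the node nonempty, the next delivery follows after one service time. If it
leaves the node empty, one has to wait for the next arrival first, and then for a service. So the
time between deliveries is a service time plus, with the probability `α` that a delivery empties
the node, the residual inter-arrival time at that moment (`toReal_interArrival_succ`). By the form
of the stationary law, the law of this residual time is a combination of shifts of `arr`; and a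
shift of `geo (ε i)` is a multiple of `geo (ε i)`, so that it is a signed mixture of the same
geometric laws (`tsum_shift_mixture`). The blocking gives `α < 1`.
-/

noncomputable section

namespace Tandem

/-! ### Expectations with respect to a probability mass function -/

/-- The expectation of a nonnegative function under a probability mass function. -/
def mean {α : Type*} (p : PMF α) (f : α → ℝ≥0∞) : ℝ≥0∞ :=
  ∑' a, p a * f a

section mean

variable {α β : Type*}

lemma mean_pure (a : α) (f : α → ℝ≥0∞) : mean (PMF.pure a) f = f a := by
  classical
  rw [mean, tsum_eq_single a]
  · simp
  · intro b hb
    simp [hb]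

lemma tsum_tsum_mul (w : α → ℝ≥0∞) (K : α → PMF β) (f : β → ℝ≥0∞) :
    ∑' y, (∑' x, w x * K x y) * f y = ∑' x, w x * mean (K x) f := by
  simp only [mean, ← ENNReal.tsum_mul_right, ← ENNReal.tsum_mul_left]
  rw [ENNReal.tsum_comm]
  simp only [mul_assoc]

lemma mean_bind (p : PMF α) (K : α → PMF β) (f : β → ℝ≥0∞) :
    mean (p.bind K) f = mean p fun a => mean (K a) f := by
  simp only [mean, PMF.bind_apply]
  exact tsum_tsum_mul _ _ _

lemma mean_map (p : PMF α) (g : α → β) (f : β → ℝ≥0∞) :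
    mean (p.map g) f = mean p fun a => f (g a) := by
  rw [← PMF.bind_pure_comp, mean_bind]
  simp [mean_pure]

lemma mean_const (p : PMF α) (c : ℝ≥0∞) : (mean p fun _ => c) = c := by
  rw [mean, ENNReal.tsum_mul_right, p.tsum_coe, one_mul]

lemma mean_congr {p : PMF α} {f g : α → ℝ≥0∞} (h : ∀ a, p a ≠ 0 → f a = g a) :
    mean p f = mean p g := by
  refine tsum_congr fun a => ?_
  by_cases ha : p a = 0
  · simp [ha]
  · rw [h a ha]

lemma mean_comm (p : PMF α) (p' : PMF β) (f : α → β → ℝ≥0∞) :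
    (mean p fun a => mean p' fun b => f a b) = mean p' fun b => mean p fun a => f a b := by
  simp only [mean, ← ENNReal.tsum_mul_left]
  rw [ENNReal.tsum_comm]
  simp only [mul_left_comm]

lemma mean_bool (p : PMF Bool) (f : Bool → ℝ≥0∞) :
    mean p f = p true * f true + p false * f false := by
  rw [mean, tsum_bool, add_comm]

end mean

/-! ### Invariant laws of Markov kernels -/

section kernel

variable {α β : Type*}

lemma eq_of_le_of_tsum_eq {f g : α → ℝ≥0∞} (hle : ∀ a, f a ≤ g a) (hf : ∑' a, f a ≠ ∞)
    (hsum : ∑' a, f a = ∑' a, g a) : f = g := by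
  by_contra hne
  obtain ⟨a, ha⟩ := Function.ne_iff.1 hne
  exact (ENNReal.tsum_lt_tsum hf hle (lt_of_le_of_ne (hle a) ha)).ne hsum

lemma tsum_tsum_kernel (w : α → ℝ≥0∞) (K : α → PMF β) :
    ∑' y, ∑' x, w x * K x y = ∑' x, w x := by
  rw [ENNReal.tsum_comm]
  simp [ENNReal.tsum_mul_left, PMF.tsum_coe]

lemma normalize_bind (K : α → PMF α) (w : α → ℝ≥0∞) (h0 : ∑' x, w x ≠ 0) (ht : ∑' x, w x ≠ ∞)
    (hw : ∀ y, ∑' x, w x * K x y = w y) :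
    (PMF.normalize w h0 ht).bind K = PMF.normalize w h0 ht := by
  ext y
  simp only [PMF.bind_apply, PMF.normalize_apply]
  simp_rw [mul_right_comm _ (∑' x, w x)⁻¹]
  rw [ENNReal.tsum_mul_right, hw]

/-- A Markov kernel on a finite type has an invariant law: `1` is an eigenvalue of its matrix, and
the positive part of a real left eigenvector is again invariant. -/
theorem exists_invariant_of_finite {ι : Type*} [Fintype ι] [Nonempty ι] (K : ι → PMF ι) :
    ∃ π : PMF ι, π.bind K = π := by
  classical
  have hrow (i : ι) : ∑ j, (K i j).toReal = 1 := by
    have h := (K i).tsum_coe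
    rw [tsum_fintype] at h
    rw [← ENNReal.toReal_sum fun j _ => (K i).apply_ne_top j, h, ENNReal.toReal_one]
  have hdet : (Matrix.of (fun i j => (K i j).toReal) - 1 : Matrix ι ι ℝ).det = 0 := by
    refine Matrix.exists_mulVec_eq_zero_iff.1 ⟨fun _ => 1, ?_, ?_⟩
    · exact Function.ne_iff.2 ⟨Classical.arbitrary ι, one_ne_zero⟩
    · rw [Matrix.sub_mulVec, Matrix.one_mulVec]
      ext i
      simp [Matrix.mulVec, dotProduct, hrow]
  obtain ⟨v, hv0, hv⟩ := Matrix.exists_vecMul_eq_zero_iff.2 hdet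
  have hinv (j : ι) : ∑ i, v i * (K i j).toReal = v j := by
    have := congrFun hv j
    rw [Matrix.vecMul_sub, Matrix.vecMul_one] at this
    simpa [Matrix.vecMul, dotProduct, sub_eq_zero] using this
  -- up to its sign, the eigenvector has a positive entry
  obtain ⟨v, hinv, i₀, hi₀⟩ :
      ∃ v : ι → ℝ, (∀ j, ∑ i, v i * (K i j).toReal = v j) ∧ ∃ i, 0 < v i := by
    obtain ⟨i, hi⟩ := Function.ne_iff.1 hv0
    rcases lt_or_gt_of_ne hi with h | h
    · refine ⟨-v, fun j => ?_, i, by simpa using h⟩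
      simp [hinv j]
    · exact ⟨v, hinv, i, h⟩
  have hle (j : ι) : ENNReal.ofReal (v j) ≤ ∑' i, ENNReal.ofReal (v i) * K i j := by
    rw [tsum_fintype, ← hinv j]
    refine (ENNReal.ofReal_le_ofReal (Finset.sum_le_sum fun i _ =>
      mul_le_mul_of_nonneg_right (le_max_left (v i) 0) ENNReal.toReal_nonneg)).trans ?_
    rw [ENNReal.ofReal_sum_of_nonneg fun i _ => by positivity]
    refine Finset.sum_le_sum fun i _ => ?_
    rw [ENNReal.ofReal_mul (le_max_right _ _), ENNReal.ofReal_toReal ((K i).apply_ne_top j),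
      ENNReal.ofReal_max, ENNReal.ofReal_zero, max_eq_left zero_le]
  have htop : ∑' i, ENNReal.ofReal (v i) ≠ ∞ := by
    rw [tsum_fintype]
    exact ENNReal.sum_ne_top.2 fun i _ => ENNReal.ofReal_ne_top
  have hzero : ∑' i, ENNReal.ofReal (v i) ≠ 0 := fun h =>
    (ENNReal.ofReal_pos.2 hi₀).ne' (ENNReal.tsum_eq_zero.1 h i₀)
  have heq := eq_of_le_of_tsum_eq hle htop (tsum_tsum_kernel _ K).symm
  exact ⟨_, normalize_bind K _ hzero htop fun j => (congrFun heq j).symm⟩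

/-- A Markov kernel on `ℕ` that does not leave `{0, …, m}` has an invariant law. -/
theorem exists_invariant_of_le (m : ℕ) (K : ℕ → PMF ℕ)
    (hK : ∀ i ≤ m, ∀ j, K i j ≠ 0 → j ≤ m) :
    ∃ π : PMF ℕ, π.bind K = π := by
  let clamp : ℕ → Fin (m + 1) := fun j => ⟨min j m, by omega⟩
  obtain ⟨π, hπ⟩ := exists_invariant_of_finite fun i : Fin (m + 1) => (K i).map clamp
  have hback (i : Fin (m + 1)) : ((K i).map clamp).map Fin.val = K i := by
    rw [PMF.map_comp, ← PMF.bind_pure_comp]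
    conv_rhs => rw [← PMF.bind_pure (K i)]
    ext y
    rw [PMF.bind_apply, PMF.bind_apply]
    refine mean_congr (p := K i) fun j hj => ?_
    simp [clamp, min_eq_left (hK i (by omega) j hj)]
  refine ⟨π.map Fin.val, ?_⟩
  conv_rhs => rw [← hπ, PMF.map_bind]
  rw [PMF.bind_map]
  congr 1
  funext i
  exact (hback i).symm

/-- Every invariant measure that charges `x` charges `x₀`: the consequence for invariant measures of
`x₀` being reached from `x` with positive probability. -/
def Reaches (K : α → PMF α) (x₀ x : α) : Prop :=
  ∀ d : α → ℝ≥0∞, (∀ y, ∑' z, d z * K z y = d y) → d x ≠ 0 → d x₀ ≠ 0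

lemma Reaches.refl (K : α → PMF α) (x₀ : α) : Reaches K x₀ x₀ := fun _ _ h => h

lemma Reaches.of_step {K : α → PMF α} {x₀ x y : α} (hxy : K x y ≠ 0) (hy : Reaches K x₀ y) :
    Reaches K x₀ x := by
  refine fun d hd hx => hy d hd ?_
  rw [← hd y]
  exact fun h => mul_ne_zero hx hxy (ENNReal.tsum_eq_zero.1 h x)

/-- If some state is reached from everywhere, the invariant law is unique: for invariant `μ` and
`ν`, the differences `μ - μ ⊓ ν` and `ν - μ ⊓ ν` are invariant, and they cannot both charge the
same state. -/
theorem invariant_unique {K : α → PMF α} {x₀ : α} (hx₀ : ∀ x, Reaches K x₀ x) {μ ν : PMF α}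
    (hμ : μ.bind K = μ) (hν : ν.bind K = ν) : μ = ν := by
  have hμ' (y : α) : ∑' x, μ x * K x y = μ y := by
    conv_rhs => rw [← hμ, PMF.bind_apply]
  have hν' (y : α) : ∑' x, ν x * K x y = ν y := by
    conv_rhs => rw [← hν, PMF.bind_apply]
  let w : α → ℝ≥0∞ := fun x => min (μ x) (ν x)
  have hwtop (x : α) : w x ≠ ∞ := ne_top_of_le_ne_top (μ.apply_ne_top x) (min_le_left _ _)
  have hwsum : ∑' x, w x ≠ ∞ :=
    ne_top_of_le_ne_top μ.tsum_coe_ne_top (ENNReal.tsum_le_tsum fun x => min_le_left _ _)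
  have hw : (fun y => ∑' x, w x * K x y) = w := by
    refine eq_of_le_of_tsum_eq (fun y => le_min ?_ ?_) ?_ (tsum_tsum_kernel w K)
    · rw [← hμ' y]
      exact ENNReal.tsum_le_tsum fun x => mul_le_mul_left (min_le_left _ _) _
    · rw [← hν' y]
      exact ENNReal.tsum_le_tsum fun x => mul_le_mul_left (min_le_right _ _) _
    · rwa [tsum_tsum_kernel]
  have hdiff (ρ : PMF α) (hle : ∀ x, w x ≤ ρ x) (hρ : ∀ y, ∑' x, ρ x * K x y = ρ y) (y : α) :
      ∑' x, (ρ x - w x) * K x y = ρ y - w y := by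
    refine ENNReal.eq_sub_of_add_eq (hwtop y) ?_
    rw [← congrFun hw y, ← ENNReal.tsum_add, ← hρ y]
    exact tsum_congr fun x => by rw [← add_mul, tsub_add_cancel_of_le (hle x)]
  have heq (ρ : PMF α) (hle : ∀ x, w x ≤ ρ x) (h : ∀ x, ρ x - w x = 0) : w = ρ :=
    funext fun x => le_antisymm (hle x) (tsub_eq_zero_iff_le.1 (h x))
  by_cases h1 : ∀ x, μ x - w x = 0
  · have h : ⇑μ = ν := eq_of_le_of_tsum_eq
      (fun x => by rw [← heq μ (fun x => min_le_left _ _) h1]; exact min_le_right _ _)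
      μ.tsum_coe_ne_top (by rw [μ.tsum_coe, ν.tsum_coe])
    exact PMF.ext fun x => congrFun h x
  by_cases h2 : ∀ x, ν x - w x = 0
  · have h : ⇑ν = μ := eq_of_le_of_tsum_eq
      (fun x => by rw [← heq ν (fun x => min_le_right _ _) h2]; exact min_le_left _ _)
      ν.tsum_coe_ne_top (by rw [μ.tsum_coe, ν.tsum_coe])
    exact PMF.ext fun x => (congrFun h x).symm
  push Not at h1 h2
  obtain ⟨x, hx⟩ := h1
  obtain ⟨y, hy⟩ := h2
  have hx' := hx₀ x (fun x => μ x - w x) (hdiff μ (fun x => min_le_left _ _) hμ') hx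
  have hy' := hx₀ y (fun x => ν x - w x) (hdiff ν (fun x => min_le_right _ _) hν') hy
  rcases le_total (μ x₀) (ν x₀) with h | h
  · exact absurd (by simp [w, h]) hx'
  · exact absurd (by simp [w, h]) hy'

end kernel

/-! ### The node averaged over the remaining service time -/

lemma mean_step (m : ℕ) (arr svc : PMF ℕ) (blk : PMF Bool) (x : State) (f : State → ℝ≥0∞) :
    mean (step m arr svc blk x) f =
      mean blk fun b => mean arr fun t => mean svc fun s => f (x.next m b t s) := by
  simp only [step, mean_bind, mean_pure]

lemma tsum_state (f : State → ℝ≥0∞) : ∑' x, f x = ∑' (j) (r) (s), f ⟨j, r, s⟩ := by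
  let e : ℕ × ℕ × ℕ ≃ State :=
    ⟨fun a => ⟨a.1, a.2.1, a.2.2⟩, fun x => (x.occ, x.res, x.srv), fun _ => rfl, fun _ => rfl⟩
  rw [← e.tsum_eq f, ENNReal.tsum_prod']
  refine tsum_congr fun j => ?_
  rw [ENNReal.tsum_prod']
  rfl

/-- The law `svc` is geometric on `{1, 2, …}` with ratio `e`, expressed by a recursion that needs
neither powers nor subtraction in `ℝ≥0∞`. -/
structure IsGeometric (svc : PMF ℕ) (e : ℝ≥0∞) : Prop where
  zero : svc 0 = 0
  one_ne_zero : svc 1 ≠ 0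
  succ : ∀ s, svc (s + 2) = e * svc (s + 1)

/-- Splitting off the first trial of a geometric variable. -/
lemma IsGeometric.mean_eq {svc : PMF ℕ} {e : ℝ≥0∞} (h : IsGeometric svc e) (f : ℕ → ℝ≥0∞) :
    mean svc f = svc 1 * f 1 + e * mean svc fun s => f (s + 1) := by
  simp only [mean]
  rw [tsum_eq_zero_add' ENNReal.summable, tsum_eq_zero_add' ENNReal.summable,
    tsum_eq_zero_add' (f := fun s => svc s * f (s + 1)) ENNReal.summable]
  simp only [h.zero, zero_mul, zero_add, ← ENNReal.tsum_mul_left]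
  congr 1
  exact tsum_congr fun s => by rw [h.succ, mul_assoc]

/-- The number of packets in the first node after the departure, if any, of an epoch that starts
with `j` packets and a geometric remaining service time: a departure needs a completed service and
an unblocked packet. -/
def thin (svc : PMF ℕ) (blk : PMF Bool) (j : ℕ) : PMF ℕ :=
  svc.bind fun s => blk.bind fun b => PMF.pure (if s ≤ 1 ∧ b = false then j - 1 else j)

/-- The number of packets after an arrival at a node with `m` slots that holds `j` packets. -/
def arrive (m j : ℕ) : ℕ :=
  if j < m then j + 1 else j

lemma mean_thin (svc : PMF ℕ) (blk : PMF Bool) (j : ℕ) (f : ℕ → ℝ≥0∞) :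
    mean (thin svc blk j) f =
      mean svc fun s => mean blk fun b => f (if s ≤ 1 ∧ b = false then j - 1 else j) := by
  simp only [thin, mean_bind, mean_pure]

/-- If the remaining service time is geometric, then so it is after one epoch, independently of
the other coordinates, whose evolution is that of `thin` followed by the arrival, if any. -/
lemma mean_svc_step (m : ℕ) (arr svc : PMF ℕ) (blk : PMF Bool) {e : ℝ≥0∞}
    (h : IsGeometric svc e) (j r : ℕ) (f : State → ℝ≥0∞) :
    (mean svc fun s => mean (step m arr svc blk ⟨j, r, s⟩) f) =
      mean (thin svc blk j) fun i => mean arr fun t => mean svc fun s =>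
        f ⟨if r ≤ 1 then arrive m i else i, if r ≤ 1 then t else r - 1, s⟩ := by
  have hA (i : ℕ) : (if r ≤ 1 ∧ i < m then i + 1 else i) = if r ≤ 1 then arrive m i else i := by
    unfold arrive
    split_ifs <;> simp_all
  simp only [mean_step, mean_thin]
  rcases Nat.eq_zero_or_pos j with rfl | hj
  · simp [State.next, State.delivers, hA, mean_const]
  conv_lhs => rw [h.mean_eq]
  conv_rhs => rw [h.mean_eq]
  congr 1
  · simp [State.next, State.delivers, hA, hj]
  · congr 1
    have h1 (s : ℕ) (hs : svc s ≠ 0) : 1 ≤ s :=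
      Nat.one_le_iff_ne_zero.2 fun h0 => hs (h0 ▸ h.zero)
    rw [mean_congr (p := svc) (g := fun s => mean arr fun t =>
      f ⟨if r ≤ 1 then arrive m j else j, if r ≤ 1 then t else r - 1, s⟩)]
    · rw [mean_comm]
      rw [mean_congr (p := svc) (f := fun s => mean blk _) (g := fun _ => mean arr fun t =>
        mean svc fun s => f ⟨if r ≤ 1 then arrive m j else j, if r ≤ 1 then t else r - 1, s⟩)]
      · rw [mean_const]
      · intro s hs
        have := h1 s hs
        have h' : ¬ (s + 1 ≤ 1) := by omega
        simp [h', mean_const]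
    · intro s hs
      have := h1 s hs
      have h' : ¬ (s + 1 ≤ 1) := by omega
      have h'' : 1 < s + 1 := by omega
      simp [State.next, State.delivers, hA, hj, h', h'', mean_const]

/-- The occupancy after `u` epochs without arrivals. -/
def thinIter (svc : PMF ℕ) (blk : PMF Bool) : ℕ → ℕ → PMF ℕ
  | 0, j => PMF.pure j
  | u + 1, j => (thinIter svc blk u j).bind (thin svc blk)

lemma le_of_thin {svc : PMF ℕ} {blk : PMF Bool} {i j : ℕ} (h : thin svc blk i j ≠ 0) : j ≤ i := by
  have h' := (PMF.mem_support_iff _ _).2 h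
  simp only [thin, PMF.mem_support_bind_iff, PMF.support_pure, Set.mem_singleton_iff] at h'
  obtain ⟨s, -, b, -, rfl⟩ := h'
  split_ifs <;> omega

lemma le_of_thinIter {svc : PMF ℕ} {blk : PMF Bool} (u : ℕ) {i j : ℕ}
    (h : thinIter svc blk u i j ≠ 0) : j ≤ i := by
  induction u generalizing j with
  | zero =>
    have h' := (PMF.mem_support_iff _ _).2 h
    simp only [thinIter, PMF.support_pure, Set.mem_singleton_iff] at h'
    exact h'.le
  | succ u ih =>
    have h' := (PMF.mem_support_iff _ _).2 h
    simp only [thinIter, PMF.mem_support_bind_iff] at h'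
    obtain ⟨k, hk, hkj⟩ := h'
    exact (le_of_thin hkj).trans (ih hk)

/-- The occupancy just after an arrival epoch has a stationary law: it is a Markov chain that stays
in `{0, …, m}`. The invariance is expressed with test functions. -/
lemma exists_embedded_invariant (m : ℕ) (arr svc : PMF ℕ) (blk : PMF Bool) :
    ∃ π : PMF ℕ, ∀ f : ℕ → ℝ≥0∞,
      (mean arr fun t => mean (π.bind (thinIter svc blk t)) fun i => f (arrive m i)) =
        mean π f := by
  obtain ⟨π, hπ⟩ := exists_invariant_of_le m
    (fun i => (arr.bind fun t => thinIter svc blk t i).map (arrive m)) fun i hi j hj => by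
      have hj' := (PMF.mem_support_iff _ _).2 hj
      simp only [PMF.mem_support_map_iff, PMF.mem_support_bind_iff] at hj'
      obtain ⟨k, ⟨t, -, hk⟩, rfl⟩ := hj'
      have := le_of_thinIter t hk
      unfold arrive
      split_ifs <;> omega
  refine ⟨π, fun f => ?_⟩
  conv_rhs => rw [← hπ]
  simp only [mean_bind, mean_map]
  rw [mean_comm]

/-! ### The stationary law -/

/-- The unnormalized stationary mass of `j` packets and `r` epochs until the next arrival, where
`π u j` is the probability to find `j` packets `u` epochs after an arrival when no other arrival
has occurred: the sum, over the age `u` of the current inter-arrival time `r + u`, of the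
probabilities of this pair. There is no mass at the unreachable value `r = 0`. -/
def occResMass (arr : PMF ℕ) (π : ℕ → PMF ℕ) (j r : ℕ) : ℝ≥0∞ :=
  if r = 0 then 0 else ∑' u, arr (r + u) * π u j

lemma tsum_occResMass (arr : PMF ℕ) (π : ℕ → PMF ℕ) (g : ℕ → ℕ → ℝ≥0∞) :
    ∑' (j) (r), occResMass arr π j r * g j r =
      ∑' (r) (u), arr (r + 1 + u) * mean (π u) fun j => g j (r + 1) := by
  rw [ENNReal.tsum_comm, tsum_eq_zero_add' ENNReal.summable]
  simp only [occResMass, if_true, zero_mul, tsum_zero, zero_add, Nat.add_eq_zero_iff,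
    one_ne_zero, and_false, if_false]
  refine tsum_congr fun r => ?_
  simp only [← ENNReal.tsum_mul_right, mean, ← ENNReal.tsum_mul_left]
  rw [ENNReal.tsum_comm]
  simp only [mul_assoc]

/-- The unnormalized stationary measure is invariant. Until the next arrival, one epoch turns
`(r + 1, u)` into `(r, u + 1)`, which leaves `arr (r + u + 1)` unchanged and
accounts for all terms but those with `u = 0`, which come from the epochs with an arrival. -/
lemma occResMass_invariant (m : ℕ) (arr svc : PMF ℕ) (blk : PMF Bool) {e : ℝ≥0∞}
    (h : IsGeometric svc e) (harr : arr 0 = 0) (π : ℕ → PMF ℕ)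
    (hπ : ∀ u, π (u + 1) = (π u).bind (thin svc blk))
    (hπ0 : ∀ f : ℕ → ℝ≥0∞, (mean arr fun t => mean (π t) fun i => f (arrive m i)) = mean (π 0) f)
    (f : State → ℝ≥0∞) :
    ∑' x : State, occResMass arr π x.occ x.res * svc x.srv * mean (step m arr svc blk x) f =
      ∑' x : State, occResMass arr π x.occ x.res * svc x.srv * f x := by
  have hsum (g : State → ℝ≥0∞) : ∑' x : State, occResMass arr π x.occ x.res * svc x.srv * g x =
      ∑' (r) (u), arr (r + 1 + u) * mean (π u) fun j => mean svc fun s => g ⟨j, r + 1, s⟩ := by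
    rw [tsum_state, ← tsum_occResMass arr π fun j r => mean svc fun s => g ⟨j, r, s⟩]
    simp only [mean, ← ENNReal.tsum_mul_left, mul_assoc]
  rw [hsum, hsum]
  simp only [mean_svc_step m arr svc blk h, ← mean_bind, ← hπ]
  rw [tsum_eq_zero_add' ENNReal.summable]
  have hr (r : ℕ) : ¬ (r + 1 + 1 ≤ 1) := by omega
  simp only [hr, zero_add, le_refl, if_true, if_false, mean_const, Nat.add_sub_cancel]
  -- the mass that leaves in the epochs with an arrival comes back with a new inter-arrival time
  have h1 : ∑' u, arr (1 + u) * mean (π (u + 1)) (fun i => mean arr fun t => mean svc fun s =>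
      f ⟨arrive m i, t, s⟩) =
      ∑' r, arr (r + 1) * mean (π 0) fun j => mean svc fun s => f ⟨j, r + 1, s⟩ := by
    have h2 := hπ0 fun i => mean arr fun t => mean svc fun s => f ⟨i, t, s⟩
    rw [mean_comm (π 0)] at h2
    have h3 (g : ℕ → ℝ≥0∞) : mean arr g = ∑' t, arr (t + 1) * g (t + 1) := by
      rw [mean, tsum_eq_zero_add' ENNReal.summable, harr, zero_mul, zero_add]
    rw [h3, h3] at h2
    simpa only [add_comm] using h2
  rw [h1, ← ENNReal.tsum_add]
  refine tsum_congr fun r => ?_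
  rw [tsum_eq_zero_add' (f := fun u => arr (r + 1 + u) * _) ENNReal.summable]
  simp only [add_zero, add_assoc, add_comm 1]

/-- If the inter-arrival times have a finite mean, expressed by `hmean` as a sum of tail
probabilities, there is a stationary law in which the remaining service time is geometric and
independent of the other coordinates. -/
theorem exists_isStationary (m : ℕ) (arr svc : PMF ℕ) (blk : PMF Bool) {e : ℝ≥0∞}
    (h : IsGeometric svc e) (harr : arr 0 = 0) (hmean : ∑' (r) (u), arr (r + 1 + u) ≠ ∞) :
    ∃ (μ : PMF State) (c : ℝ≥0∞) (π : ℕ → PMF ℕ), IsStationary m arr svc blk μ ∧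
      ∀ x : State, μ x = c * occResMass arr π x.occ x.res * svc x.srv := by
  classical
  obtain ⟨π₀, hπ₀⟩ := exists_embedded_invariant m arr svc blk
  let π : ℕ → PMF ℕ := fun u => π₀.bind (thinIter svc blk u)
  have hπ (u : ℕ) : π (u + 1) = (π u).bind (thin svc blk) := by
    simp only [π, PMF.bind_bind]
    rfl
  have hπ0 : π 0 = π₀ := by
    simp only [π]
    exact PMF.bind_pure π₀
  let w : State → ℝ≥0∞ := fun x => occResMass arr π x.occ x.res * svc x.srv
  have hw : ∑' x, w x = ∑' (r) (u), arr (r + 1 + u) := by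
    have := tsum_occResMass arr π fun _ _ => 1
    simp only [mean_const, mul_one] at this
    rw [tsum_state, ← this]
    simp only [w, ENNReal.tsum_mul_left, svc.tsum_coe, mul_one]
  have hne : ∑' x, w x ≠ 0 := by
    rw [hw]
    intro h0
    obtain ⟨t, ht⟩ := arr.support_nonempty
    rcases t with _ | t
    · exact ht harr
    · exact ht (ENNReal.tsum_eq_zero.1 (ENNReal.tsum_eq_zero.1 h0 t) 0)
  have htop : ∑' x, w x ≠ ∞ := hw ▸ hmean
  have hinv (y : State) : ∑' x, w x * step m arr svc blk x y = w y := by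
    have h2 := occResMass_invariant m arr svc blk h harr π hπ (by rw [hπ0]; exact hπ₀)
      fun x => if x = y then 1 else 0
    simpa [mean, w] using h2
  refine ⟨PMF.normalize w hne htop, (∑' x, w x)⁻¹, π,
    normalize_bind _ w hne htop hinv, fun x => ?_⟩
  rw [PMF.normalize_apply, mul_comm, mul_assoc]

/-! ### Uniqueness of the stationary law -/

lemma step_next_ne_zero {m : ℕ} {arr svc : PMF ℕ} {blk : PMF Bool} (x : State) {b : Bool}
    {t s : ℕ} (hb : blk b ≠ 0) (ht : arr t ≠ 0) (hs : svc s ≠ 0) :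
    step m arr svc blk x (x.next m b t s) ≠ 0 := by
  rw [← PMF.mem_support_iff]
  simp only [step, PMF.mem_support_bind_iff, PMF.support_pure, Set.mem_singleton_iff]
  exact ⟨b, hb, t, ht, s, hs, rfl⟩

/-- The empty node with an imminent arrival is reached from every state: wait for an arrival epoch
after which the next arrival is so far away that the node can be emptied in the meantime. -/
theorem reaches_empty (m : ℕ) (arr svc : PMF ℕ) (blk : PMF Bool)
    (hblk : blk false ≠ 0) (hsvc : svc 1 ≠ 0) (harr : ∀ N, ∃ t, N ≤ t ∧ arr t ≠ 0) (x : State) :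
    Reaches (step m arr svc blk) ⟨0, 1, 1⟩ x := by
  have hnext (x : State) (t : ℕ) (ht : arr t ≠ 0)
      (hx : Reaches (step m arr svc blk) ⟨0, 1, 1⟩ (x.next m false t 1)) :
      Reaches (step m arr svc blk) ⟨0, 1, 1⟩ x :=
    .of_step (step_next_ne_zero x hblk ht hsvc) hx
  obtain ⟨t₀, -, ht₀⟩ := harr 0
  have h0 (r : ℕ) : Reaches (step m arr svc blk) ⟨0, 1, 1⟩ ⟨0, r + 1, 1⟩ := by
    induction r with
    | zero => exact .refl _ _
    | succ r ih =>
      refine hnext _ t₀ ht₀ ?_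
      simpa [State.next, State.delivers] using ih
  have hempty (j : ℕ) : ∀ s r, 2 * j + s + 3 ≤ r →
      Reaches (step m arr svc blk) ⟨0, 1, 1⟩ ⟨j, r, s⟩ := by
    induction j with
    | zero =>
      intro s r hr
      obtain ⟨r, rfl⟩ := Nat.exists_eq_add_of_le' (show 2 ≤ r by omega)
      refine hnext _ t₀ ht₀ ?_
      simpa [State.next, State.delivers] using h0 r
    | succ j ihj =>
      intro s
      induction s with
      | zero =>
        intro r hr
        refine hnext _ t₀ ht₀ ?_
        have h1 : ¬ r ≤ 1 := by omega
        simpa [State.next, State.delivers, h1] using ihj 1 (r - 1) (by omega)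
      | succ s ihs =>
        intro r hr
        refine hnext _ t₀ ht₀ ?_
        have h1 : ¬ r ≤ 1 := by omega
        rcases Nat.eq_zero_or_pos s with rfl | hs
        · simpa [State.next, State.delivers, h1] using ihj 1 (r - 1) (by omega)
        · have h2 : s ≠ 0 := by omega
          simpa [State.next, State.delivers, h1, h2, hs] using ihs (r - 1) (by omega)
  obtain ⟨j, r, s⟩ := x
  induction r using Nat.strong_induction_on generalizing j s with
  | _ r ih =>
    by_cases hr : r ≤ 1
    · -- occupancy and remaining service after the arrival do not depend on the new `t`
      let y := State.next m ⟨j, r, s⟩ false 0 1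
      obtain ⟨t, ht, hat⟩ := harr (2 * y.occ + y.srv + 3)
      refine hnext _ t hat ?_
      have hy : State.next m ⟨j, r, s⟩ false t 1 = ⟨y.occ, t, y.srv⟩ := by
        simp [y, State.next, hr]
      rw [hy]
      exact hempty _ _ _ ht
    · refine hnext _ t₀ ht₀ ?_
      have hy : State.next m ⟨j, r, s⟩ false t₀ 1 =
          ⟨(State.next m ⟨j, r, s⟩ false t₀ 1).occ, r - 1,
            (State.next m ⟨j, r, s⟩ false t₀ 1).srv⟩ := by
        simp [State.next, hr]
      rw [hy]
      exact ih (r - 1) (by omega) _ _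

/-! ### The time until the first delivery -/

lemma firstDelivery_zero (m : ℕ) (arr svc : PMF ℕ) (blk : PMF Bool) (x : State) :
    firstDelivery m arr svc blk 0 x = if x.delivers then 1 else 0 := rfl

lemma firstDelivery_succ (m : ℕ) (arr svc : PMF ℕ) (blk : PMF Bool) (k : ℕ) (x : State) :
    firstDelivery m arr svc blk (k + 1) x =
      if x.delivers then 0 else mean (step m arr svc blk x) (firstDelivery m arr svc blk k) := rfl

/-- While the node is busy, the next delivery takes place at the end of the current service. -/
lemma firstDelivery_busy (m : ℕ) (arr svc : PMF ℕ) (blk : PMF Bool) (k : ℕ) :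
    ∀ j r s, 0 < j → 1 ≤ s →
      firstDelivery m arr svc blk k ⟨j, r, s⟩ = if s = k + 1 then 1 else 0 := by
  induction k with
  | zero =>
    intro j r s hj hs
    have : s ≤ 1 ↔ s = 1 := by omega
    simp [firstDelivery_zero, State.delivers, hj, this]
  | succ k ih =>
    intro j r s hj hs
    rw [firstDelivery_succ]
    rcases hs.eq_or_lt with rfl | hs
    · simp [State.delivers, hj]
    · have h1 : ¬ s ≤ 1 := by omega
      have h2 : s - 1 = k + 1 ↔ s = k + 1 + 1 := by omega
      have h3 (t s' : ℕ) (b : Bool) : firstDelivery m arr svc blk k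
          (State.next m ⟨j, r, s⟩ b t s') = if s = k + 1 + 1 then 1 else 0 := by
        have : State.next m ⟨j, r, s⟩ b t s' = ⟨(State.next m ⟨j, r, s⟩ b t s').occ,
            (State.next m ⟨j, r, s⟩ b t s').res, s - 1⟩ := by
          simp [State.next, hj, hs]
        rw [this, ih _ _ _ _ (by omega)]
        · simp only [h2]
        · simp only [State.next, State.delivers, h1, and_false, false_and, if_false]
          split_ifs <;> omega
      simp only [mean_step, h3, mean_const]
      simp [State.delivers, h1]

lemma mean_firstDelivery_busy (m : ℕ) (arr svc : PMF ℕ) (blk : PMF Bool) (hsvc : svc 0 = 0)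
    (k j r : ℕ) (hj : 0 < j) :
    (mean svc fun s => firstDelivery m arr svc blk k ⟨j, r, s⟩) = svc (k + 1) := by
  rw [mean_congr (g := fun s => if s = k + 1 then 1 else 0)]
  · simp [mean]
  · intro s hs
    exact firstDelivery_busy m arr svc blk k j r s hj
      (Nat.one_le_iff_ne_zero.2 fun h => hs (h ▸ hsvc))

/-- From the empty node, the first delivery takes place after the residual inter-arrival time and
a full service time. -/
lemma firstDelivery_empty (m : ℕ) (hm : 0 < m) (arr svc : PMF ℕ) (blk : PMF Bool)
    (hsvc : svc 0 = 0) (k : ℕ) :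
    ∀ r s, 1 ≤ r → firstDelivery m arr svc blk k ⟨0, r, s⟩ = svc (k + 1 - r) := by
  induction k with
  | zero =>
    intro r s hr
    have : 0 + 1 - r = 0 := by omega
    simp [firstDelivery_zero, State.delivers, this, hsvc]
  | succ k ih =>
    intro r s hr
    rw [firstDelivery_succ, if_neg (by simp [State.delivers]), mean_step]
    rcases hr.eq_or_lt with rfl | hr
    · simp [State.next, State.delivers, hm, mean_firstDelivery_busy, hsvc, mean_const]
    · have h1 : ¬ r ≤ 1 := by omega
      simp only [State.next, State.delivers, h1, lt_irrefl, false_and, if_false]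
      simp only [ih (r - 1) _ (by omega), mean_const]
      congr 1
      omega

/-- After a delivery that leaves the node empty, the next delivery waits for an arrival and a
service; after any other delivery it waits for a service only. -/
lemma mean_step_firstDelivery (m : ℕ) (hm : 0 < m) (arr svc : PMF ℕ) (blk : PMF Bool)
    (hsvc : svc 0 = 0) (k j r : ℕ) :
    mean (step m arr svc blk ⟨j + 1, r, 1⟩) (firstDelivery m arr svc blk k) +
        (if j = 0 ∧ 2 ≤ r then blk false * svc (k + 1) else 0) =
      svc (k + 1) + if j = 0 ∧ 2 ≤ r then blk false * svc (k + 2 - r) else 0 := by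
  have hblk : blk true + blk false = 1 := by
    rw [← blk.tsum_coe, tsum_bool, add_comm]
  rw [mean_step, mean_bool]
  have htrue : (mean arr fun t => mean svc fun s =>
      firstDelivery m arr svc blk k (State.next m ⟨j + 1, r, 1⟩ true t s)) = svc (k + 1) := by
    have h1 (t s : ℕ) : State.next m ⟨j + 1, r, 1⟩ true t s =
        ⟨if r ≤ 1 ∧ j + 1 < m then j + 2 else j + 1, if r ≤ 1 then t else r - 1, s⟩ := by
      simp [State.next]
    have h2 : 0 < if r ≤ 1 ∧ j + 1 < m then j + 2 else j + 1 := by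
      split_ifs <;> omega
    simp only [h1, mean_firstDelivery_busy m arr svc blk hsvc k _ _ h2, mean_const]
  have hnext (t s : ℕ) : State.next m ⟨j + 1, r, 1⟩ false t s =
      ⟨if r ≤ 1 ∧ j < m then j + 1 else j, if r ≤ 1 then t else r - 1, s⟩ := by
    simp [State.next, State.delivers]
  simp only [htrue, hnext]
  by_cases h : j = 0 ∧ 2 ≤ r
  · obtain ⟨rfl, hr⟩ := h
    have h1 : ¬ r ≤ 1 := by omega
    have h2 : k + 1 - (r - 1) = k + 2 - r := by omega
    simp only [h1, hr, false_and, and_self, if_true, if_false,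
      firstDelivery_empty m hm arr svc blk hsvc k (r - 1) _ (by omega), mean_const, h2]
    nth_rw 3 [← one_mul (svc (k + 1))]
    rw [← hblk]
    ring
  · have h2 : 0 < if r ≤ 1 ∧ j < m then j + 1 else j := by
      split_ifs <;> omega
    simp only [h, if_false, add_zero, mean_firstDelivery_busy m arr svc blk hsvc k _ _ h2,
      mean_const, ← add_mul, hblk, one_mul]

/-! ### The inter-arrival times at the second node -/

/-- A sum over the epochs with a delivery, for a law of product form in the service time. -/
lemma tsum_delivers {μ : PMF State} {svc : PMF ℕ} (hsvc : svc 0 = 0) {V : ℕ → ℕ → ℝ≥0∞}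
    (hμ : ∀ x : State, μ x = V x.occ x.res * svc x.srv) (g : State → ℝ≥0∞) :
    (∑' x : State, if x.delivers then μ x * g x else 0) =
      svc 1 * ∑' (j) (r), V (j + 1) r * g ⟨j + 1, r, 1⟩ := by
  rw [tsum_state, tsum_eq_zero_add' ENNReal.summable]
  simp only [State.delivers, lt_irrefl, false_and, if_false, tsum_zero, zero_add,
    ← ENNReal.tsum_mul_left]
  refine tsum_congr fun j => tsum_congr fun r => ?_
  rw [tsum_eq_single 1]
  · simp only [hμ, Nat.succ_pos, le_refl, and_self, if_true]
    ring
  · intro s hs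
    rcases Nat.lt_or_gt_of_ne hs with h | h
    · obtain rfl : s = 0 := by omega
      simp [hμ, hsvc]
    · exact if_neg (by omega)

/-- The law of the times between deliveries, multiplied by the probability of a delivery, with the
correction for deliveries that empty the node on both sides to avoid subtraction. -/
lemma tsum_delivers_firstDelivery (m : ℕ) (hm : 0 < m) (arr svc : PMF ℕ) (blk : PMF Bool)
    (hsvc : svc 0 = 0) {μ : PMF State} {V : ℕ → ℕ → ℝ≥0∞}
    (hμ : ∀ x : State, μ x = V x.occ x.res * svc x.srv) (k : ℕ) :
    (∑' x : State, if x.delivers then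
        μ x * mean (step m arr svc blk x) (firstDelivery m arr svc blk k) else 0) +
        svc 1 * (blk false * (∑' r, V 1 (r + 2)) * svc (k + 1)) =
      svc 1 * ((∑' (j) (r), V (j + 1) r) * svc (k + 1) +
        blk false * ∑ r ∈ Finset.range k, V 1 (r + 2) * svc (k - r)) := by
  have hempty (f : ℕ → ℝ≥0∞) : ∑' (j) (r), V (j + 1) r *
      (if j = 0 ∧ 2 ≤ r then blk false * f r else 0) =
        blk false * ∑' r, V 1 (r + 2) * f (r + 2) := by
    rw [tsum_eq_single 0 (by intro j hj; simp [hj]), tsum_eq_zero_add' ENNReal.summable,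
      tsum_eq_zero_add' ENNReal.summable, ← ENNReal.tsum_mul_left]
    simp [mul_left_comm, add_assoc]
  have h1 := hempty fun _ => svc (k + 1)
  have h2 := hempty fun r => svc (k + 2 - r)
  rw [ENNReal.tsum_mul_right, ← mul_assoc] at h1
  rw [tsum_delivers hsvc hμ, ← mul_add, ← h1, ← ENNReal.tsum_add]
  congr 1
  simp only [← ENNReal.tsum_add, ← mul_add, mean_step_firstDelivery m hm arr svc blk hsvc]
  simp only [mul_add, ENNReal.tsum_add, h2, ENNReal.tsum_mul_right]
  simp only [Nat.add_sub_add_right]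
  rw [tsum_eq_sum (L := .unconditional ℕ) (s := Finset.range k)
    (f := fun r => V 1 (r + 2) * svc (k - r))]
  intro r hr
  rw [Finset.mem_range, not_lt] at hr
  rw [Nat.sub_eq_zero_of_le hr, hsvc, mul_zero]

/-- The times between deliveries are a service time plus, with probability
`α = blk false * C / B`, a residual inter-arrival time with law `V 1 (· + 1) / C`. Here `B` is the
mass of the nonempty states, and `C` is the mass of the states with a single packet and no arrival
in the current epoch, where a delivery empties the node unless it is blocked. -/
theorem toReal_interArrival_succ (m : ℕ) (hm : 0 < m) (arr svc : PMF ℕ) (blk : PMF Bool)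
    (hsvc : svc 0 = 0) (hsvc1 : svc 1 ≠ 0) {μ : PMF State} {V : ℕ → ℕ → ℝ≥0∞}
    (hμ : ∀ x : State, μ x = V x.occ x.res * svc x.srv) (hV : ∀ j r, V j r ≠ ∞)
    {B C : ℝ≥0∞} (hB : B = ∑' (j) (r), V (j + 1) r) (hC : C = ∑' r, V 1 (r + 2))
    (hB0 : B ≠ 0) (hBt : B ≠ ∞) (hCt : C ≠ ∞) (k : ℕ) :
    (interArrival m arr svc blk μ (k + 1)).toReal =
      (svc (k + 1)).toReal - (blk false).toReal * C.toReal / B.toReal * (svc (k + 1)).toReal +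
        (blk false).toReal / B.toReal *
          ∑ r ∈ Finset.range k, (V 1 (r + 2)).toReal * (svc (k - r)).toReal := by
  have h := tsum_delivers_firstDelivery m hm arr svc blk hsvc hμ k
  have hden := tsum_delivers hsvc hμ fun _ => 1
  simp only [mul_one] at hden
  rw [← hB] at h hden
  rw [← hC] at h
  have hI : interArrival m arr svc blk μ (k + 1) = (∑' x : State, if x.delivers then
        μ x * mean (step m arr svc blk x) (firstDelivery m arr svc blk k) else 0) / (svc 1 * B) := by
    rw [← hden]
    rfl
  rw [hI]
  set N := ∑' x : State, if x.delivers then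
        μ x * mean (step m arr svc blk x) (firstDelivery m arr svc blk k) else 0
  have hs1 := svc.apply_ne_top 1
  have hsk := svc.apply_ne_top (k + 1)
  have hbf := blk.apply_ne_top false
  have hsum : ∀ r ∈ Finset.range k, V 1 (r + 2) * svc (k - r) ≠ ∞ := fun r _ =>
    ENNReal.mul_ne_top (hV _ _) (svc.apply_ne_top _)
  have hrhs : svc 1 * (B * svc (k + 1) +
        blk false * ∑ r ∈ Finset.range k, V 1 (r + 2) * svc (k - r)) ≠ ∞ :=
    ENNReal.mul_ne_top hs1 (ENNReal.add_ne_top.2 ⟨ENNReal.mul_ne_top hBt hsk,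
      ENNReal.mul_ne_top hbf (ENNReal.sum_ne_top.2 hsum)⟩)
  have hN : N ≠ ∞ := fun h' => hrhs (by rw [← h, h', top_add])
  have h' := congrArg ENNReal.toReal h
  rw [ENNReal.toReal_add hN (by finiteness), ENNReal.toReal_mul, ENNReal.toReal_mul,
    ENNReal.toReal_mul, ENNReal.toReal_mul, ENNReal.toReal_add (by finiteness)
    (ENNReal.mul_ne_top hbf (ENNReal.sum_ne_top.2 hsum)), ENNReal.toReal_mul, ENNReal.toReal_mul,
    ENNReal.toReal_sum hsum] at h'
  simp only [ENNReal.toReal_mul] at h'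
  have hs1' : (svc 1).toReal ≠ 0 := (ENNReal.toReal_pos hsvc1 hs1).ne'
  have hB' : B.toReal ≠ 0 := (ENNReal.toReal_pos hB0 hBt).ne'
  rw [ENNReal.toReal_div, ENNReal.toReal_mul, eq_sub_of_add_eq h']
  field_simp
  ring

/-! ### Signed mixtures of geometric laws -/

section mixture

variable {n : ℕ} {ε p : Fin n → ℝ} {arr : PMF ℕ}

lemma toReal_mixture_succ (harr : ∀ k, (arr k).toReal = ∑ i, p i * geo (ε i) k) (k : ℕ) :
    (arr (k + 1)).toReal = ∑ i, p i * (1 - ε i) * ε i ^ k := by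
  simp [harr, geo, mul_assoc]

lemma mixture_zero (harr : ∀ k, (arr k).toReal = ∑ i, p i * geo (ε i) k) : arr 0 = 0 := by
  have h := harr 0
  simp only [geo, if_true, mul_zero, Finset.sum_const_zero] at h
  exact ((ENNReal.toReal_eq_zero_iff _).1 h).resolve_right (arr.apply_ne_top 0)

/-- A signed mixture of geometric laws has unbounded support, as distinct exponential sequences are
linearly independent. -/
lemma exists_mixture_ne_zero (hε : ∀ i, ε i ∈ Set.Ioo (0 : ℝ) 1) (hεinj : Function.Injective ε)
    (harr : ∀ k, (arr k).toReal = ∑ i, p i * geo (ε i) k) (N : ℕ) : ∃ t, N ≤ t ∧ arr t ≠ 0 := by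
  by_contra! hcon
  have hv : (fun i => p i * (1 - ε i) * ε i ^ N) = 0 := by
    refine Matrix.eq_zero_of_forall_pow_sum_mul_pow_eq_zero hεinj fun k => ?_
    have h := toReal_mixture_succ harr (N + k)
    rw [hcon _ (by omega), ENNReal.toReal_zero] at h
    simpa only [pow_add, mul_assoc] using h.symm
  have hp (i : Fin n) : p i = 0 := by
    have h := congrFun hv i
    have h1 := (hε i).1.ne'
    have h2 : 1 - ε i ≠ 0 := (sub_pos.2 (hε i).2).ne'
    simpa [h1, h2] using h
  have hzero (k : ℕ) : arr k = 0 := by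
    have h := harr k
    simp only [hp, zero_mul, Finset.sum_const_zero] at h
    exact ((ENNReal.toReal_eq_zero_iff _).1 h).resolve_right (arr.apply_ne_top k)
  exact arr.coe_ne_zero (funext hzero)

/-- A signed mixture of geometric laws has a finite mean. -/
lemma tsum_tsum_mixture_ne_top (hε : ∀ i, ε i ∈ Set.Ioo (0 : ℝ) 1)
    (harr : ∀ k, (arr k).toReal = ∑ i, p i * geo (ε i) k) :
    ∑' (r) (u), arr (r + 1 + u) ≠ ∞ := by
  let E : Fin n → ℝ≥0∞ := fun i => ENNReal.ofReal (ε i)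
  have hle (r u : ℕ) :
      arr (r + 1 + u) ≤ ∑ i, ENNReal.ofReal |p i| * E i ^ r * E i ^ u := by
    rw [add_right_comm, ← ENNReal.ofReal_toReal (arr.apply_ne_top (r + u + 1)),
      toReal_mixture_succ harr]
    refine (ENNReal.ofReal_le_ofReal (Finset.sum_le_sum fun i _ =>
      (?_ : _ ≤ |p i| * ε i ^ r * ε i ^ u))).trans ?_
    · have h0 := (hε i).1
      have h1 := (hε i).2
      rw [mul_assoc, mul_assoc, ← pow_add]
      refine (mul_le_mul_of_nonneg_right (le_abs_self (p i)) ?_).trans ?_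
      · exact mul_nonneg (by linarith) (by positivity)
      · refine mul_le_mul_of_nonneg_left ?_ (abs_nonneg _)
        exact mul_le_of_le_one_left (by positivity) (by linarith)
    · rw [ENNReal.ofReal_sum_of_nonneg fun i _ => by
        have := (hε i).1
        positivity]
      refine Finset.sum_le_sum fun i _ => le_of_eq ?_
      have h0 := (hε i).1.le
      rw [ENNReal.ofReal_mul (by positivity), ENNReal.ofReal_mul (by positivity),
        ENNReal.ofReal_pow h0, ENNReal.ofReal_pow h0]
  refine ne_top_of_le_ne_top ?_ (ENNReal.tsum_le_tsum fun r => ENNReal.tsum_le_tsum fun u => hle r u)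
  have hE (i : Fin n) : (1 - E i)⁻¹ ≠ ∞ :=
    ENNReal.inv_ne_top.2 (tsub_pos_of_lt (ENNReal.ofReal_lt_one.2 (hε i).2)).ne'
  simp_rw [Summable.tsum_finsetSum fun _ _ => ENNReal.summable]
  simp only [ENNReal.tsum_mul_left, ENNReal.tsum_mul_right, ENNReal.tsum_geometric]
  exact ENNReal.sum_ne_top.2 fun i _ =>
    ENNReal.mul_ne_top (ENNReal.mul_ne_top ENNReal.ofReal_ne_top (hE i)) (hE i)

/-- Sums of shifts of a signed mixture of geometric laws are such mixtures again. The shift by `2`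
is due to the residual time `r + 1` being that after an epoch that starts with residual time
`r + 2`. -/
lemma tsum_shift_mixture (hε : ∀ i, ε i ∈ Set.Ioo (0 : ℝ) 1)
    (harr : ∀ k, (arr k).toReal = ∑ i, p i * geo (ε i) k) {a : ℕ → ℝ≥0∞} (ha : ∀ u, a u ≤ 1)
    (r : ℕ) :
    (∑' u, arr (r + 2 + u) * a u).toReal =
      ∑ i, (p i * ε i * ∑' u, ε i ^ u * (a u).toReal) * ((1 - ε i) * ε i ^ r) := by
  have hat (u : ℕ) : a u ≠ ∞ := ne_top_of_le_ne_top ENNReal.one_ne_top (ha u)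
  have hsum (i : Fin n) : Summable fun u => ε i ^ u * (a u).toReal := by
    have h0 := (hε i).1.le
    refine Summable.of_nonneg_of_le (fun u => by positivity) (fun u => ?_)
      (summable_geometric_of_lt_one h0 (hε i).2)
    exact mul_le_of_le_one_right (by positivity)
      (ENNReal.toReal_mono ENNReal.one_ne_top (ha u))
  rw [ENNReal.tsum_toReal_eq fun u => ENNReal.mul_ne_top (arr.apply_ne_top _) (hat u)]
  have hterm (u : ℕ) : (arr (r + 2 + u) * a u).toReal =
      ∑ i, p i * ε i * ((1 - ε i) * ε i ^ r) * (ε i ^ u * (a u).toReal) := by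
    rw [ENNReal.toReal_mul, show r + 2 + u = r + 1 + u + 1 by omega, toReal_mixture_succ harr,
      Finset.sum_mul]
    exact Finset.sum_congr rfl fun i _ => by ring
  simp only [hterm]
  rw [Summable.tsum_finsetSum fun i _ => (hsum i).mul_left _]
  refine Finset.sum_congr rfl fun i _ => ?_
  rw [tsum_mul_left]
  ring

end mixture

lemma isGeometric_of_toReal {εs : ℝ} (hεs : εs ∈ Set.Ioo (0 : ℝ) 1) {svc : PMF ℕ}
    (hsvc : ∀ k, (svc k).toReal = geo εs k) : IsGeometric svc (ENNReal.ofReal εs) where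
  zero := by
    have h := hsvc 0
    simp only [geo, if_true] at h
    exact ((ENNReal.toReal_eq_zero_iff _).1 h).resolve_right (svc.apply_ne_top 0)
  one_ne_zero := fun h0 => by
    have h := hsvc 1
    have := hεs.2
    simp [h0, geo] at h
    linarith
  succ := fun s => by
    rw [← ENNReal.toReal_eq_toReal_iff' (svc.apply_ne_top _)
      (ENNReal.mul_ne_top ENNReal.ofReal_ne_top (svc.apply_ne_top _)), ENNReal.toReal_mul,
      ENNReal.toReal_ofReal hεs.1.le, hsvc, hsvc]
    simp [geo, pow_succ]
    ring

end Tandem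

end

/-! ### The steady state of the tandem -/

theorem mainTheorem5
    (m : ℕ) (hm : 0 < m)
    (n : ℕ) (ε : Fin n → ℝ) (hε : ∀ i, ε i ∈ Set.Ioo (0 : ℝ) 1) (hεinj : Function.Injective ε)
    (εs : ℝ) (hεs : εs ∈ Set.Ioo (0 : ℝ) 1) (hεne : ∀ i, εs ≠ ε i)
    (p : Fin n → ℝ)
    (arr : PMF ℕ) (harr : ∀ k, (arr k).toReal = ∑ i, p i * Tandem.geo (ε i) k)
    (svc : PMF ℕ) (hsvc : ∀ k, (svc k).toReal = Tandem.geo εs k)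
    (q : ℝ) (hq : q ∈ Set.Ioo (0 : ℝ) 1)
    (blk : PMF Bool) (hblk : (blk true).toReal = q) :
    (∃! μ : PMF Tandem.State, Tandem.IsStationary m arr svc blk μ) ∧
    ∃ (α : ℝ) (p' : Fin n → ℝ), α ∈ Set.Ioo (0 : ℝ) 1 ∧ ∑ l, p' l = 1 ∧
      (∀ k, 0 ≤ ∑ l, p' l * Tandem.geo (ε l) k) ∧
      ∀ μ : PMF Tandem.State, Tandem.IsStationary m arr svc blk μ →
        ∀ k, (Tandem.interArrival m arr svc blk μ k).toReal =
          Tandem.convolve (fun j => (1 - α) * Tandem.idConv j + α * ∑ l, p' l * Tandem.geo (ε l) j) (Tandem.geo εs) k := by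
  have hgeo := Tandem.isGeometric_of_toReal hεs hsvc
  have harr0 := Tandem.mixture_zero harr
  have hsupp := Tandem.exists_mixture_ne_zero hε hεinj harr
  have hblk' : (blk false).toReal = 1 - q := by
    have h := blk.tsum_coe
    rw [tsum_bool] at h
    have h' := congrArg ENNReal.toReal h
    rw [ENNReal.toReal_add (blk.apply_ne_top _) (blk.apply_ne_top _), hblk,
      ENNReal.toReal_one] at h'
    linarith
  have hbf : blk false ≠ 0 := fun h0 => by
    rw [h0, ENNReal.toReal_zero] at hblk'
    linarith [hq.2]
  have hreach := Tandem.reaches_empty m arr svc blk hbf hgeo.one_ne_zero hsupp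
  obtain ⟨μ, c, π, hstat, hμ⟩ := Tandem.exists_isStationary m arr svc blk hgeo harr0
    (Tandem.tsum_tsum_mixture_ne_top hε harr)
  have huniq (ν : PMF Tandem.State) (hν : Tandem.IsStationary m arr svc blk ν) : ν = μ :=
    Tandem.invariant_unique hreach hν hstat
  refine ⟨⟨μ, hstat, huniq⟩, ?_⟩
  set V : ℕ → ℕ → ℝ≥0∞ := fun j r => c * Tandem.occResMass arr π j r with hVdef
  have hμV (x : Tandem.State) : μ x = V x.occ x.res * svc x.srv := hμ x
  have hVsum : ∑' (j) (r), V j r = 1 := by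
    rw [← μ.tsum_coe, Tandem.tsum_state]
    simp only [hμV, ENNReal.tsum_mul_left, svc.tsum_coe, mul_one]
  set B := ∑' (j) (r), V (j + 1) r with hB
  set C := ∑' r, V 1 (r + 2) with hC
  have hCB : C ≤ B := by
    refine le_trans ?_ (ENNReal.le_tsum (f := fun j => ∑' r, V (j + 1) r) 0)
    exact ENNReal.tsum_comp_le_tsum_of_injective (add_left_injective 2) (V 1)
  have hB1 : B ≤ 1 := by
    rw [← hVsum]
    exact ENNReal.tsum_comp_le_tsum_of_injective (add_left_injective 1) fun j => ∑' r, V j r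
  have hBt : B ≠ ∞ := ne_top_of_le_ne_top ENNReal.one_ne_top hB1
  have hCt : C ≠ ∞ := ne_top_of_le_ne_top hBt hCB
  have hV (j r : ℕ) : V j r ≠ ∞ := by
    refine ne_top_of_le_ne_top ENNReal.one_ne_top (hVsum ▸ ?_)
    exact (ENNReal.le_tsum (f := fun r => V j r) r).trans
      (ENNReal.le_tsum (f := fun j => ∑' r, V j r) j)
  have hC0 : C ≠ 0 := by
    intro h0
    -- the chain visits the empty node just before an arrival, and one step later it is in a
    -- state that counts for `C`
    obtain ⟨t, ht, hat⟩ := hsupp 2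
    obtain ⟨t, rfl⟩ := Nat.exists_eq_add_of_le' ht
    have hinv (y : Tandem.State) : ∑' x, μ x * Tandem.step m arr svc blk x y = μ y := by
      conv_rhs => rw [← hstat, PMF.bind_apply]
    obtain ⟨x, hx⟩ := μ.support_nonempty
    have hx0 := hreach x μ hinv hx
    have hstep := Tandem.step_next_ne_zero (m := m) ⟨0, 1, 1⟩ hbf hat hgeo.one_ne_zero
    have hnext : Tandem.State.next m ⟨0, 1, 1⟩ false (t + 2) 1 = ⟨1, t + 2, 1⟩ := by
      simp [Tandem.State.next, Tandem.State.delivers, hm]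
    rw [hnext] at hstep
    have h1 : μ ⟨1, t + 2, 1⟩ ≠ 0 := by
      rw [← hinv]
      exact fun h => mul_ne_zero hx0 hstep (ENNReal.tsum_eq_zero.1 h _)
    rw [hμV] at h1
    exact h1 (by rw [ENNReal.tsum_eq_zero.1 h0 t, zero_mul])
  have hB0 : B ≠ 0 := fun h => hC0 (le_antisymm (h ▸ hCB) zero_le)
  have hCpos : 0 < C.toReal := ENNReal.toReal_pos hC0 hCt
  have hBpos : 0 < B.toReal := ENNReal.toReal_pos hB0 hBt
  have hCB' : C.toReal ≤ B.toReal := ENNReal.toReal_mono hBt hCB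
  -- the residual inter-arrival time after a departure that empties the node
  set w : Fin n → ℝ := fun i => c.toReal * (p i * ε i * ∑' u, ε i ^ u * (π u 1).toReal) with hw
  have hVw (r : ℕ) : (V 1 (r + 2)).toReal = ∑ i, w i * ((1 - ε i) * ε i ^ r) := by
    simp only [hVdef, Tandem.occResMass, Nat.add_eq_zero_iff, two_ne_zero, and_false, if_false,
      ENNReal.toReal_mul]
    rw [Tandem.tsum_shift_mixture hε harr (fun u => (π u).coe_le_one 1), Finset.mul_sum]
    exact Finset.sum_congr rfl fun i _ => by rw [hw]; ring
  have hCw : C.toReal = ∑ i, w i := by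
    rw [hC, ENNReal.tsum_toReal_eq fun r => hV _ _]
    simp only [hVw]
    have hs (i : Fin n) : Summable fun r => ε i ^ r :=
      summable_geometric_of_lt_one (hε i).1.le (hε i).2
    rw [Summable.tsum_finsetSum fun i _ => ((hs i).mul_left _).mul_left _]
    refine Finset.sum_congr rfl fun i _ => ?_
    have h1 : 1 - ε i ≠ 0 := (sub_pos.2 (hε i).2).ne'
    rw [tsum_mul_left, tsum_mul_left, tsum_geometric_of_lt_one (hε i).1.le (hε i).2,
      mul_inv_cancel₀ h1, mul_one]
  have hmix (r : ℕ) :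
      ∑ l, w l / C.toReal * Tandem.geo (ε l) (r + 1) = (V 1 (r + 2)).toReal / C.toReal := by
    rw [hVw, Finset.sum_div]
    refine Finset.sum_congr rfl fun i _ => ?_
    simp only [Tandem.geo, Nat.add_eq_zero_iff, one_ne_zero, and_false, if_false,
      Nat.add_sub_cancel]
    ring
  refine ⟨(1 - q) * C.toReal / B.toReal, fun l => w l / C.toReal, ⟨?_, ?_⟩, ?_, ?_, ?_⟩
  · have := sub_pos.2 hq.2
    positivity
  · rw [div_lt_one hBpos]
    nlinarith [hq.1]
  · rw [← Finset.sum_div, ← hCw, div_self hCpos.ne']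
  · rintro (_ | r)
    · simp [Tandem.geo]
    · rw [hmix]
      positivity
  · intro ν hν k
    rw [huniq ν hν]
    rcases k with _ | k
    · simp [Tandem.interArrival, Tandem.convolve, Tandem.geo]
    rw [Tandem.toReal_interArrival_succ m hm arr svc blk hgeo.zero hgeo.one_ne_zero hμV hV hB hC
      hB0 hBt hCt, hblk', Tandem.convolve, Finset.sum_range_succ', Finset.sum_range_succ]
    simp only [hmix, hsvc, Tandem.idConv, Nat.add_eq_zero_iff, one_ne_zero, and_false, if_false,
      if_true, mul_zero, zero_add, Nat.add_sub_add_right, Nat.sub_self, Nat.sub_zero]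
    have h0 : Tandem.geo εs 0 = 0 := by simp [Tandem.geo]
    have h0' : ∑ l, w l / C.toReal * Tandem.geo (ε l) 0 = 0 := by simp [Tandem.geo]
    rw [h0, h0', Finset.mul_sum]
    have hterm (r : ℕ) : (1 - q) * C.toReal / B.toReal * ((V 1 (r + 2)).toReal / C.toReal) =
        (1 - q) / B.toReal * (V 1 (r + 2)).toReal := by
      field_simp
    simp only [hterm, mul_assoc]
    ring
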